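/- **Theorem (first-order regret of semi-bandit Thompson Sampling).** There is a universal constant $C>0$ such that the following holds. Let $d,m\ge 0$ and $T\ge 2$ be integers, and let $\mathcal A\subset\{0,1\}^d$ be a nonempty set of actions with $\|a\|_1=m$ for all $a\in\mathcal A$. Let $(\ell_1,\dots,\ell_T)$ be a random sequence of loss vectors in $[0,1]^d$ with an arbitrary law (the prior; no independence across rounds or coordinates is assumed), put $L^*=\min_{a\in\mathcal A}\sum_{t=1}^T\langle \ell_t,a\rangle$, and let $a^*\in\mathcal A$ be a random action attaining this minimum (ties broken in any measurable, possibly random, way). In round $t$ the player chooses $a_t\in\mathcal A$, suffers the loss $\langle\ell_t,a_t\rangle$, and observes only $\ell_t\odot a_t$ (the losses of the active coordinates). Suppose that the player uses Thompson Sampling: for each $t$, conditionally on the history $\mathcal H_t=\sigma(a_s,\ \ell_s\odot a_s : s<t)$ and on $(\ell_1,\dots,\ell_T,a^*)$, the action $a_t$ has law $p_t$, where $p_t(b)=\mathbb P(a^*=b\mid\mathcal H_t)$ is the posterior distribution of $a^*$. Let $R_T=\sum_{t=1}^T\langle\ell_t,a_t\rangle-L^*$. Then $$\mathbb E[R_T]\le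 C\left(\sqrt{d\,\mathbb E[L^*]\,\log T}+d\log T\right).$$ In particular, no almost-sure upper bound on $L^*$ is assumed. -/

import Mathlib

open MeasureTheory ProbabilityTheory

noncomputable section

namespace SemiBandit

/-- A combinatorial action: a vector in `{0,1}^d`. -/
abbrev Act (d : ℕ) : Type := Fin d → Bool

/-- The `ℓ¹` norm of a `0/1` vector: the number of its active coordinates. -/
def size {d : ℕ} (b : Act d) : ℕ := (Finset.univ.filter fun i => b i = true).card

/-- The instantaneous loss `⟨x, b⟩` of the action `b` against the loss vector `x`. -/
def pairing {d : ℕ} (x : Fin d → ℝ) (b : Act d) : ℝ := ∑ i, if b i = true then x i else 0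

/-- The semi-bandit feedback `x ⊙ b`: the losses of the active coordinates. -/
def feedback {d : ℕ} (x : Fin d → ℝ) (b : Act d) : Fin d → ℝ :=
  fun i => if b i = true then x i else 0

/-- The total loss of the fixed action `b` against the loss sequence `x`. -/
def totalLoss {d T : ℕ} (x : Fin T → Fin d → ℝ) (b : Act d) : ℝ := ∑ t, pairing (x t) b

/-- `L^*`, the total loss of the best fixed action in hindsight. -/
def bestLoss {d T : ℕ} (A : Finset (Act d)) (hA : A.Nonempty) (x : Fin T → Fin d → ℝ) : ℝ :=
  A.inf' hA (totalLoss x)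

/-- `R_T`, the regret of the played actions `a` against the loss sequence `x`. -/
def regret {d T : ℕ} (A : Finset (Act d)) (hA : A.Nonempty)
    (x : Fin T → Fin d → ℝ) (a : Fin T → Act d) : ℝ :=
  (∑ t, pairing (x t) (a t)) - bestLoss A hA x

/-- What the player has seen before round `t`: the `σ`-algebra generated by the past actions
and the past feedback, `(a_s, ℓ_s ⊙ a_s)` for `s < t`. -/
@[reducible]
def history {Ω : Type*} {d T : ℕ} (ℓ : Ω → Fin T → Fin d → ℝ) (a : Fin T → Ω → Act d)
    (t : Fin T) : MeasurableSpace Ω :=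
  ⨆ s : {s : Fin T // s < t},
    MeasurableSpace.comap (fun ω => (a s.1 ω, feedback (ℓ ω s.1) (a s.1 ω))) inferInstance

/-- The random actions `a_t` on the probability space `(Ω, μ)` are those of Thompson Sampling with
semi-bandit feedback and action set `A`, for the random loss sequence `ℓ` (whose law under `μ` is
the prior, an arbitrary law on `[0,1]^{T × d}`) and the random optimal action `astar`. -/
structure IsThompsonSampling {Ω : Type*} [MeasurableSpace Ω] (μ : Measure Ω) {d T : ℕ}
    (A : Finset (Act d)) (ℓ : Ω → Fin T → Fin d → ℝ) (astar : Ω → Act d)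
    (a : Fin T → Ω → Act d) : Prop where
  measurable_loss : Measurable ℓ
  loss_mem : ∀ᵐ ω ∂μ, ∀ t i, ℓ ω t i ∈ Set.Icc (0 : ℝ) 1
  measurable_astar : Measurable astar
  astar_mem : ∀ᵐ ω ∂μ, astar ω ∈ A
  /-- `astar` minimizes the total loss over `A`; ties may be broken in any way. -/
  astar_le : ∀ᵐ ω ∂μ, ∀ b ∈ A, totalLoss (ℓ ω) (astar ω) ≤ totalLoss (ℓ ω) b
  measurable_action : ∀ t, Measurable (a t)
  /-- In round `t` the action is drawn, with fresh external randomness, from the posterior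
  distribution of `astar` given the history: conditionally on the history and on the hidden
  variables `ℓ` and `astar`, the law of `a t` is `b ↦ ℙ(astar = b | history)`. -/
  posterior_sampling : ∀ (t : Fin T) (b : Act d),
    μ⟦{ω | a t ω = b} |
      history ℓ a t ⊔ MeasurableSpace.comap (fun ω => (ℓ ω, astar ω)) inferInstance⟧
      =ᵐ[μ] μ⟦{ω | astar ω = b} | history ℓ a t⟧

end SemiBandit

end

/-! ### One coordinate, one round -/

namespace SemiBandit

/-! The proof tracks, for each coordinate, the expected log-barrier potential `𝔼 log (q + ε)` of the
posterior marginal `q` that the coordinate is optimal. Let `X` be the loss, `B` and `Z` the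
indicators that the coordinate is played and optimal, `q'` the marginal after the feedback. By `log
x ≤ x - 1`, the potential's increment plus `𝔼 (y - y ^ 2)`, `y = η B X`, is at most `𝔼 g (q' + ε) -
1` with `g = (1 + y) / (q + ε)`. As `g` depends only on what has been observed, `q'` may be replaced
by `Z`. Posterior sampling then turns `B` into `q`, which cancels the denominator and leaves at most
`η 𝔼 Z X + η ε`.

Hence the regret of a coordinate in a round is at most `ε + η 𝔼 B X` plus `1 / η` times the drop of
the potential (`coordinate_regret_le`). With `ε = 1 / T` the drops telescope to at most `log (T +
1)`. Summed over coordinates, the terms `𝔼 B X` give `𝔼 L^* + 𝔼 R_T`, so the bound is first-order,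
and since `η` is a free parameter of the analysis it can be tuned to `𝔼 L^*`. -/

lemma integral_mul_condExp_of_bound {Ω : Type*} {m m0 : MeasurableSpace Ω} (hm : m ≤ m0)
    (μ : Measure[m0] Ω) [IsProbabilityMeasure μ] {g f : Ω → ℝ} (hg : StronglyMeasurable[m] g)
    (hf : Integrable f μ) {c : ℝ} (hc : ∀ᵐ ω ∂μ, ‖g ω‖ ≤ c) :
    ∫ ω, g ω * (μ[f|m]) ω ∂μ = ∫ ω, g ω * f ω ∂μ := by
  have hgf : Integrable (g * f) μ :=
    hf.bdd_mul (hg.mono hm).aestronglyMeasurable hc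
  rw [← integral_condExp hm (f := fun ω => g ω * f ω)]
  exact integral_congr_ae (condExp_mul_of_stronglyMeasurable_left hg hgf hf).symm

lemma condExp_mem_Icc {Ω : Type*} {m m0 : MeasurableSpace Ω} (hm : m ≤ m0)
    (μ : Measure[m0] Ω) [IsProbabilityMeasure μ] {f : Ω → ℝ} (hf : Integrable f μ)
    (h01 : ∀ ω, f ω ∈ Set.Icc (0 : ℝ) 1) : ∀ᵐ ω ∂μ, (μ[f|m]) ω ∈ Set.Icc (0 : ℝ) 1 := by
  have h0 : 0 ≤ᵐ[μ] μ[f|m] := condExp_nonneg (Filter.Eventually.of_forall fun ω => (h01 ω).1)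
  have h1 : μ[f|m] ≤ᵐ[μ] μ[fun _ => (1 : ℝ)|m] :=
    condExp_mono hf (integrable_const _) (Filter.Eventually.of_forall fun ω => (h01 ω).2)
  rw [condExp_const hm] at h1
  filter_upwards [h0, h1] with ω a b using ⟨a, b⟩

/-- The bound `log x ≤ x - 1` at `x = p * (1 + y) / q`, with `log (1 + y)` estimated from below. -/
lemma log_sub_log_add_le {p q y : ℝ} (hp : 0 < p) (hq : 0 < q) (hy : 0 ≤ y) :
    Real.log p - Real.log q + (y - y ^ 2) ≤ p * ((1 + y) / q) - 1 := by
  have h1 : Real.log (p * ((1 + y) / q)) ≤ p * ((1 + y) / q) - 1 :=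
    Real.log_le_sub_one_of_pos (by positivity)
  rw [Real.log_mul hp.ne' (by positivity), Real.log_div (by positivity) hq.ne'] at h1
  have h2 := Real.one_sub_inv_le_log_of_pos (show 0 < 1 + y by positivity)
  have h3 : y - y ^ 2 ≤ 1 - (1 + y)⁻¹ := by
    have : 1 - (1 + y)⁻¹ - (y - y ^ 2) = y ^ 3 / (1 + y) := by
      field_simp
      ring
    have : 0 ≤ y ^ 3 / (1 + y) := by positivity
    linarith
  linarith

/-- The increment of the logarithmic potential of the posterior probability `μ[Z|F]` of an event
controls the regret in one coordinate: `X` is the loss, `B` the indicator that the coordinate is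
played, `Z` the indicator that it is optimal. -/
lemma coordinate_regret_le {Ω : Type*} {F G H m0 : MeasurableSpace Ω} (μ : Measure[m0] Ω)
    [IsProbabilityMeasure μ] (hFG : F ≤ G) (hFH : F ≤ H) (hG : G ≤ m0) (hH : H ≤ m0)
    {X B Z : Ω → ℝ} (hX : StronglyMeasurable[H] X) (hZ : StronglyMeasurable[H] Z)
    (hB : StronglyMeasurable[m0] B) (hBX : StronglyMeasurable[G] fun ω => B ω * X ω)
    (hX01 : ∀ᵐ ω ∂μ, X ω ∈ Set.Icc (0 : ℝ) 1) (hB01 : ∀ ω, B ω ∈ Set.Icc (0 : ℝ) 1)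
    (hZ01 : ∀ ω, Z ω ∈ Set.Icc (0 : ℝ) 1) (hBZ : μ[B|H] =ᵐ[μ] μ[Z|F])
    {ε η : ℝ} (hε : 0 < ε) (hη : 0 < η) :
    η * (∫ ω, B ω * X ω ∂μ - ∫ ω, Z ω * X ω ∂μ) ≤
      η * ε + η ^ 2 * ∫ ω, B ω * X ω ∂μ
        + (∫ ω, Real.log ((μ[Z|F]) ω + ε) ∂μ - ∫ ω, Real.log ((μ[Z|G]) ω + ε) ∂μ) := by
  have hF : F ≤ m0 := hFG.trans hG
  have hZi : Integrable Z μ := .of_bound (hZ.mono hH).aestronglyMeasurable 1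
    (.of_forall fun ω => by simpa [abs_of_nonneg (hZ01 ω).1] using (hZ01 ω).2)
  have hBi : Integrable B μ := .of_bound hB.aestronglyMeasurable 1
    (.of_forall fun ω => by simpa [abs_of_nonneg (hB01 ω).1] using (hB01 ω).2)
  set q := μ[Z|F]
  set q' := μ[Z|G]
  have q01 : ∀ᵐ ω ∂μ, q ω ∈ Set.Icc (0 : ℝ) 1 := condExp_mem_Icc hF μ hZi hZ01
  have q'01 : ∀ᵐ ω ∂μ, q' ω ∈ Set.Icc (0 : ℝ) 1 := condExp_mem_Icc hG μ hZi hZ01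
  have qm : StronglyMeasurable[F] q := stronglyMeasurable_condExp
  have q'm : StronglyMeasurable[G] q' := stronglyMeasurable_condExp
  have qmeas : Measurable[m0] q := (qm.mono hF).measurable
  have q'meas : Measurable[m0] q' := (q'm.mono hG).measurable
  have BXmeas : Measurable[m0] fun ω => B ω * X ω := (hBX.mono hG).measurable
  have Xmeas : Measurable[m0] X := (hX.mono hH).measurable
  have Zmeas : Measurable[m0] Z := (hZ.mono hH).measurable
  have BX01 : ∀ᵐ ω ∂μ, B ω * X ω ∈ Set.Icc (0 : ℝ) 1 := by
    filter_upwards [hX01] with ω hx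
    exact ⟨mul_nonneg (hB01 ω).1 hx.1, mul_le_one₀ (hB01 ω).2 hx.1 hx.2⟩
  have iBX : Integrable (fun ω => B ω * X ω) μ := by
    refine .of_bound BXmeas.aestronglyMeasurable 1 ?_
    filter_upwards [BX01] with ω h
    simpa only [Real.norm_eq_abs, abs_of_nonneg h.1] using h.2
  have iZX : Integrable (fun ω => Z ω * X ω) μ := by
    refine .of_bound (Zmeas.mul Xmeas).aestronglyMeasurable 1 ?_
    filter_upwards [hX01] with ω h
    rw [Real.norm_eq_abs, abs_of_nonneg (mul_nonneg (hZ01 ω).1 h.1)]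
    exact mul_le_one₀ (hZ01 ω).2 h.1 h.2
  have ilog : ∀ r : Ω → ℝ, Measurable[m0] r → (∀ᵐ ω ∂μ, r ω ∈ Set.Icc (0 : ℝ) 1) →
      Integrable (fun ω => Real.log (r ω + ε)) μ := by
    intro r hr h01
    refine .of_bound (Real.measurable_log.comp (hr.add_const ε)).aestronglyMeasurable
      (max (Real.log (1 + ε)) (-Real.log ε)) ?_
    filter_upwards [h01] with ω h
    have h0 := h.1
    have h1 := h.2
    refine abs_le'.2 ⟨le_max_of_le_left (Real.log_le_log (by positivity) (by linarith)),
      le_max_of_le_right (neg_le_neg (Real.log_le_log hε (by linarith)))⟩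
  -- The test weight must be `G`-measurable: it involves the loss only through the observed product
  -- `B X`. The shift `ε` keeps it bounded.
  set g : Ω → ℝ := fun ω => (1 + η * (B ω * X ω)) / (q ω + ε) with hg
  have gm : StronglyMeasurable[G] g :=
    ((((hBX.measurable.const_mul η).const_add 1).div
      (((qm.mono hFG).measurable).add_const ε))).stronglyMeasurable
  have gb : ∀ᵐ ω ∂μ, ‖g ω‖ ≤ (1 + η) / ε := by
    filter_upwards [BX01, q01] with ω h h'
    have h0 := h.1
    have h1 := h.2
    have h2 := h'.1
    rw [Real.norm_eq_abs, abs_of_nonneg (by positivity)]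
    exact div_le_div₀ (by positivity) (by nlinarith) hε (by linarith)
  have ig : Integrable g μ := .of_bound (gm.mono hG).aestronglyMeasurable _ gb
  have igr : ∀ r : Ω → ℝ, Integrable r μ → Integrable (fun ω => g ω * r ω) μ := fun r hr =>
    hr.bdd_mul (gm.mono hG).aestronglyMeasurable gb
  have e1 : ∫ ω, g ω * q' ω ∂μ = ∫ ω, g ω * Z ω ∂μ :=
    integral_mul_condExp_of_bound hG μ gm hZi gb
  set h : Ω → ℝ := fun ω => (q ω + ε)⁻¹ with hh
  have hm : StronglyMeasurable[F] h := (qm.measurable.add_const ε).inv.stronglyMeasurable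
  have hb : ∀ᵐ ω ∂μ, ‖h ω‖ ≤ ε⁻¹ := by
    filter_upwards [q01] with ω h'
    have h2 := h'.1
    rw [Real.norm_eq_abs, abs_of_nonneg (by positivity)]
    exact inv_anti₀ hε (by linarith)
  have ih : Integrable h μ := .of_bound (hm.mono hF).aestronglyMeasurable _ hb
  have ihr : ∀ r : Ω → ℝ, Integrable r μ → Integrable (fun ω => h ω * r ω) μ := fun r hr =>
    hr.bdd_mul (hm.mono hF).aestronglyMeasurable hb
  have e2 : ∫ ω, h ω * q ω ∂μ = ∫ ω, h ω * Z ω ∂μ :=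
    integral_mul_condExp_of_bound hF μ hm hZi hb
  have e2' : ∫ ω, h ω * Z ω ∂μ + ε * ∫ ω, h ω ∂μ = 1 := by
    rw [← e2, ← integral_const_mul, ← integral_add (ihr _ integrable_condExp) (ih.const_mul ε)]
    rw [show (1 : ℝ) = ∫ _, (1 : ℝ) ∂μ by simp]
    refine integral_congr_ae ?_
    filter_upwards [q01] with ω h'
    have : 0 < q ω + ε := by linarith [h'.1]
    rw [show h ω * q ω + ε * h ω = h ω * (q ω + ε) by ring]
    exact inv_mul_cancel₀ this.ne'
  -- The coefficient of `η B` in `g (Z + ε)`. It involves the hidden `X` and `Z` but not the action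
  -- of the round, so it is `H`-measurable.
  set k : Ω → ℝ := fun ω => X ω * (Z ω + ε) * h ω with hk
  have km : StronglyMeasurable[H] k :=
    (hX.mul (hZ.measurable.add_const ε).stronglyMeasurable).mul (hm.mono hFH)
  have kb : ∀ᵐ ω ∂μ, ‖k ω‖ ≤ (1 + ε) * ε⁻¹ := by
    filter_upwards [hX01, hb] with ω hx hh
    simp only [hk]
    rw [norm_mul]
    refine mul_le_mul ?_ hh (norm_nonneg _) (by positivity)
    have := (hZ01 ω).1
    have := (hZ01 ω).2
    have := hx.1
    rw [Real.norm_eq_abs, abs_of_nonneg (by positivity)]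
    nlinarith [hx.2]
  -- Posterior sampling enters here: given `H`, the mean of `B` is `q`.
  have e3 : ∫ ω, k ω * B ω ∂μ = ∫ ω, k ω * q ω ∂μ := by
    rw [← integral_mul_condExp_of_bound hH μ km hBi kb]
    refine integral_congr_ae ?_
    filter_upwards [hBZ] with ω hω
    rw [hω]
  have ikr : ∀ r : Ω → ℝ, Integrable r μ → Integrable (fun ω => k ω * r ω) μ := fun r hr =>
    hr.bdd_mul (km.mono hH).aestronglyMeasurable kb
  have e4 : ∫ ω, k ω * q ω ∂μ ≤ ∫ ω, Z ω * X ω ∂μ + ε := by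
    have : ∫ ω, Z ω * X ω ∂μ + ε = ∫ ω, (Z ω * X ω + ε) ∂μ := by
      rw [integral_add iZX (integrable_const _)]
      simp
    rw [this]
    refine integral_mono_ae (ikr _ integrable_condExp) (iZX.add (integrable_const _)) ?_
    filter_upwards [hX01, q01] with ω hx hq
    have hz := hZ01 ω
    have hpos : 0 < q ω + ε := by linarith [hq.1]
    simp only [hk, hh]
    have h1 : (q ω + ε)⁻¹ * q ω ≤ 1 := by
      rw [inv_mul_le_iff₀ hpos]
      linarith
    have h2 : 0 ≤ X ω * (Z ω + ε) := mul_nonneg hx.1 (by linarith [hz.1])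
    calc X ω * (Z ω + ε) * (q ω + ε)⁻¹ * q ω
        = X ω * (Z ω + ε) * ((q ω + ε)⁻¹ * q ω) := by ring
      _ ≤ X ω * (Z ω + ε) * 1 := mul_le_mul_of_nonneg_left h1 h2
      _ ≤ Z ω * X ω + ε := by nlinarith [hx.2]
  have e5 : ∫ ω, g ω * Z ω ∂μ + ε * ∫ ω, g ω ∂μ =
      (∫ ω, h ω * Z ω ∂μ + ε * ∫ ω, h ω ∂μ) + η * ∫ ω, k ω * B ω ∂μ := by
    rw [← integral_const_mul, ← integral_const_mul, ← integral_const_mul,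
      ← integral_add (igr _ hZi) (ig.const_mul ε), ← integral_add (ihr _ hZi) (ih.const_mul ε),
      ← integral_add (f := fun ω => h ω * Z ω + ε * h ω)
        ((ihr _ hZi).add (ih.const_mul ε)) ((ikr _ hBi).const_mul η)]
    refine integral_congr_ae (.of_forall fun ω => ?_)
    simp only [hg, hk, hh, div_eq_mul_inv]
    ring
  have e6 : ∫ ω, Real.log (q' ω + ε) ∂μ - ∫ ω, Real.log (q ω + ε) ∂μ
      + (η - η ^ 2) * ∫ ω, B ω * X ω ∂μ ≤
      ∫ ω, g ω * q' ω ∂μ + ε * ∫ ω, g ω ∂μ - 1 := by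
    have i1 : Integrable (fun ω => Real.log (q' ω + ε) - Real.log (q ω + ε)) μ :=
      (ilog q' q'meas q'01).sub (ilog q qmeas q01)
    have i2 := iBX.const_mul (η - η ^ 2)
    have i3 : Integrable (fun ω => g ω * q' ω + ε * g ω) μ :=
      (igr q' integrable_condExp).add (ig.const_mul ε)
    have l1 : ∫ ω, Real.log (q' ω + ε) ∂μ - ∫ ω, Real.log (q ω + ε) ∂μ
        + (η - η ^ 2) * ∫ ω, B ω * X ω ∂μ = ∫ ω, (Real.log (q' ω + ε) - Real.log (q ω + ε)
          + (η - η ^ 2) * (B ω * X ω)) ∂μ := by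
      rw [← integral_sub (ilog q' q'meas q'01) (ilog q qmeas q01), ← integral_const_mul,
        ← integral_add i1 i2]
    have l2 : ∫ ω, g ω * q' ω ∂μ + ε * ∫ ω, g ω ∂μ - 1
        = ∫ ω, (g ω * q' ω + ε * g ω - 1) ∂μ := by
      rw [integral_sub i3 (integrable_const _),
        integral_add (igr q' integrable_condExp) (ig.const_mul ε), integral_const_mul]
      simp
    rw [l1, l2]
    refine integral_mono_ae (i1.add i2) (i3.sub (integrable_const _)) ?_
    filter_upwards [BX01, q01, q'01] with ω hbx hq hq'
    have := log_sub_log_add_le (p := q' ω + ε) (q := q ω + ε) (y := η * (B ω * X ω))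
      (by linarith [hq'.1]) (by linarith [hq.1]) (mul_nonneg hη.le hbx.1)
    -- `(B X) ^ 2 ≤ B X` because `B X` lies in `[0, 1]`; the second-order term is thus paid by the
    -- loss itself, which makes the bound first-order.
    have hsq : (η * (B ω * X ω)) ^ 2 ≤ η ^ 2 * (B ω * X ω) := by
      rw [mul_pow]
      exact mul_le_mul_of_nonneg_left (by nlinarith [hbx.1, hbx.2]) (sq_nonneg η)
    simp only [hg]
    linarith
  have e7 := mul_le_mul_of_nonneg_left e4 hη.le
  rw [e1, e5, e2', e3] at e6
  linarith

/-! ### Observations and coordinates of actions -/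

/-- The `σ`-algebra generated by the first `n` actions and feedbacks; unlike `history`, it is also
defined after the last round. -/
@[reducible]
def observed {Ω : Type*} {d T : ℕ} (ℓ : Ω → Fin T → Fin d → ℝ) (a : Fin T → Ω → Act d)
    (n : ℕ) : MeasurableSpace Ω :=
  ⨆ s : {s : Fin T // (s : ℕ) < n},
    MeasurableSpace.comap (fun ω => (a s.1 ω, feedback (ℓ ω s.1) (a s.1 ω))) inferInstance

lemma observed_mono {Ω : Type*} {d T : ℕ} (ℓ : Ω → Fin T → Fin d → ℝ)
    (a : Fin T → Ω → Act d) {k n : ℕ} (h : k ≤ n) : observed ℓ a k ≤ observed ℓ a n :=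
  iSup_le fun s => le_iSup (fun s : {s : Fin T // (s : ℕ) < n} =>
    MeasurableSpace.comap (fun ω => (a s.1 ω, feedback (ℓ ω s.1) (a s.1 ω))) inferInstance)
    ⟨s.1, s.2.trans_le h⟩

/-- The coordinate `i` of an action, as a real number. -/
noncomputable def coord {d : ℕ} (i : Fin d) (b : Act d) : ℝ := if b i = true then 1 else 0

lemma coord_mem_Icc {d : ℕ} (i : Fin d) (b : Act d) : coord i b ∈ Set.Icc (0 : ℝ) 1 := by
  unfold coord
  split_ifs <;> simp

lemma pairing_eq_sum_coord {d : ℕ} (x : Fin d → ℝ) (b : Act d) :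
    pairing x b = ∑ i, coord i b * x i := by
  simp [pairing, coord]

lemma feedback_eq_coord {d : ℕ} (x : Fin d → ℝ) (b : Act d) (i : Fin d) :
    feedback x b i = coord i b * x i := by
  simp [feedback, coord]

lemma measurable_coord {d : ℕ} (i : Fin d) : Measurable (coord (d := d) i) :=
  Measurable.ite (measurableSet_eq_fun (measurable_pi_apply i) measurable_const)
    measurable_const measurable_const

lemma coord_comp_eq_sum {Ω : Type*} {d : ℕ} (i : Fin d) (f : Ω → Act d) :
    (fun ω => coord i (f ω)) = ∑ b ∈ Finset.univ.filter fun b : Act d => b i = true,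
      Set.indicator {ω | f ω = b} fun _ => (1 : ℝ) := by
  ext ω
  simp [coord, Finset.sum_apply, Set.indicator_apply, Finset.sum_ite_eq]

/-- The loss alone is not observable, only its product with the played coordinate, and only once
round `t` is over, hence the index `t + 1`. -/
lemma stronglyMeasurable_feedback {Ω : Type*} {d T : ℕ} (ℓ : Ω → Fin T → Fin d → ℝ)
    (a : Fin T → Ω → Act d) (t : Fin T) (i : Fin d) :
    StronglyMeasurable[observed ℓ a (t + 1)] fun ω => coord i (a t ω) * ℓ ω t i := by
  refine Measurable.stronglyMeasurable ?_
  have h1 : Measurable[MeasurableSpace.comap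
      (fun ω => (a t ω, feedback (ℓ ω t) (a t ω))) inferInstance]
      fun ω => coord i (a t ω) * ℓ ω t i := by
    have : (fun ω => coord i (a t ω) * ℓ ω t i) =
        (fun p : Act d × (Fin d → ℝ) => p.2 i) ∘
          fun ω => (a t ω, feedback (ℓ ω t) (a t ω)) := by
      ext ω
      simp [feedback_eq_coord]
    rw [this]
    exact ((measurable_pi_apply i).comp measurable_snd).comp (comap_measurable _)
  exact h1.mono (le_iSup (fun s : {s : Fin T // (s : ℕ) < t + 1} =>
    MeasurableSpace.comap (fun ω => (a s.1 ω, feedback (ℓ ω s.1) (a s.1 ω))) inferInstance)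
    ⟨t, Nat.lt_succ_self _⟩) le_rfl

/-! ### Integrals under Thompson Sampling -/

namespace IsThompsonSampling

variable {Ω : Type*} [mΩ : MeasurableSpace Ω] {μ : Measure Ω} {d T : ℕ} {A : Finset (Act d)}
  {ℓ : Ω → Fin T → Fin d → ℝ} {astar : Ω → Act d} {a : Fin T → Ω → Act d}

lemma measurable_coord_loss (h : IsThompsonSampling μ A ℓ astar a) (t : Fin T) (i : Fin d) :
    Measurable fun ω => ℓ ω t i :=
  measurable_pi_iff.1 (measurable_pi_iff.1 h.measurable_loss t) i

lemma measurable_feedback (h : IsThompsonSampling μ A ℓ astar a) (t : Fin T) :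
    Measurable fun ω => feedback (ℓ ω t) (a t ω) := by
  refine measurable_pi_iff.2 fun i => ?_
  simp only [feedback_eq_coord]
  exact ((measurable_coord i).comp (h.measurable_action t)).mul (h.measurable_coord_loss t i)

lemma observed_le (h : IsThompsonSampling μ A ℓ astar a) (n : ℕ) : observed ℓ a n ≤ mΩ :=
  iSup_le fun s =>
    ((h.measurable_action s.1).prodMk (h.measurable_feedback s.1)).comap_le

/-- Posterior sampling of whole actions passes to marginals, by summing over the finitely many
actions that contain `i`. -/
lemma condExp_coord [IsProbabilityMeasure μ] (h : IsThompsonSampling μ A ℓ astar a) (t : Fin T)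
    (i : Fin d) :
    μ[fun ω => coord i (a t ω) |
      history ℓ a t ⊔ MeasurableSpace.comap (fun ω => (ℓ ω, astar ω)) inferInstance]
      =ᵐ[μ] μ[fun ω => coord i (astar ω) | history ℓ a t] := by
  have hi : ∀ f : Ω → Act d, Measurable f → ∀ b : Act d,
      Integrable (Set.indicator {ω | f ω = b} fun _ => (1 : ℝ)) μ := fun f hf b =>
    (integrable_const _).indicator (hf (Set.toFinite {b}).measurableSet)
  rw [coord_comp_eq_sum, coord_comp_eq_sum]
  refine (condExp_finsetSum (fun b _ => hi _ (h.measurable_action t) b) _).trans ?_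
  refine Filter.EventuallyEq.trans ?_
    (condExp_finsetSum (fun b _ => hi _ h.measurable_astar b) _).symm
  have := (ae_all_iff (μ := μ)).2 fun b => h.posterior_sampling t b
  filter_upwards [this] with ω hω
  simp only [Finset.sum_apply]
  exact Finset.sum_congr rfl fun b _ => hω b

lemma integrable_coord_mul [IsProbabilityMeasure μ] (h : IsThompsonSampling μ A ℓ astar a)
    {f : Ω → Act d} (hf : Measurable f) (t : Fin T) (i : Fin d) :
    Integrable (fun ω => coord i (f ω) * ℓ ω t i) μ := by
  refine .of_bound (((measurable_coord i).comp hf).mul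
    (h.measurable_coord_loss t i)).aestronglyMeasurable 1 ?_
  filter_upwards [h.loss_mem] with ω hω
  have h1 := coord_mem_Icc i (f ω)
  rw [Real.norm_eq_abs, abs_of_nonneg (mul_nonneg h1.1 (hω t i).1)]
  exact mul_le_one₀ h1.2 (hω t i).1 (hω t i).2

lemma integrable_pairing [IsProbabilityMeasure μ] (h : IsThompsonSampling μ A ℓ astar a)
    {f : Ω → Act d} (hf : Measurable f) (t : Fin T) :
    Integrable (fun ω => pairing (ℓ ω t) (f ω)) μ := by
  simp only [pairing_eq_sum_coord]
  exact integrable_finsetSum _ fun i _ => h.integrable_coord_mul hf t i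

lemma integral_pairing [IsProbabilityMeasure μ] (h : IsThompsonSampling μ A ℓ astar a)
    {f : Ω → Act d} (hf : Measurable f) (t : Fin T) :
    ∫ ω, pairing (ℓ ω t) (f ω) ∂μ = ∑ i, ∫ ω, coord i (f ω) * ℓ ω t i ∂μ := by
  simp only [pairing_eq_sum_coord]
  exact integral_finsetSum _ fun i _ => h.integrable_coord_mul hf t i

lemma bestLoss_ae_eq (h : IsThompsonSampling μ A ℓ astar a) (hA : A.Nonempty) :
    (fun ω => bestLoss A hA (ℓ ω)) =ᵐ[μ] fun ω => ∑ t, pairing (ℓ ω t) (astar ω) := by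
  filter_upwards [h.astar_mem, h.astar_le] with ω h1 h2
  exact le_antisymm (Finset.inf'_le _ h1) (Finset.le_inf' _ _ h2)

lemma integrable_bestLoss [IsProbabilityMeasure μ] (h : IsThompsonSampling μ A ℓ astar a)
    (hA : A.Nonempty) : Integrable (fun ω => bestLoss A hA (ℓ ω)) μ :=
  (integrable_finsetSum _ fun t _ => h.integrable_pairing h.measurable_astar t).congr
    (h.bestLoss_ae_eq hA).symm

lemma integral_bestLoss [IsProbabilityMeasure μ] (h : IsThompsonSampling μ A ℓ astar a)
    (hA : A.Nonempty) : ∫ ω, bestLoss A hA (ℓ ω) ∂μ =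
      ∑ i, ∑ t, ∫ ω, coord i (astar ω) * ℓ ω t i ∂μ := by
  rw [integral_congr_ae (h.bestLoss_ae_eq hA),
    integral_finsetSum _ fun t _ => h.integrable_pairing h.measurable_astar t, Finset.sum_comm]
  exact Finset.sum_congr rfl fun t _ => h.integral_pairing h.measurable_astar t

lemma integral_regret [IsProbabilityMeasure μ] (h : IsThompsonSampling μ A ℓ astar a)
    (hA : A.Nonempty) : ∫ ω, regret A hA (ℓ ω) (fun t => a t ω) ∂μ =
      ∑ i, ∑ t, ∫ ω, coord i (a t ω) * ℓ ω t i ∂μ - ∫ ω, bestLoss A hA (ℓ ω) ∂μ := by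
  have hi : ∀ t, Integrable (fun ω => pairing (ℓ ω t) (a t ω)) μ :=
    fun t => h.integrable_pairing (h.measurable_action t) t
  unfold regret
  rw [integral_sub (integrable_finsetSum _ fun t _ => hi t) (h.integrable_bestLoss hA),
    integral_finsetSum _ fun t _ => hi t, Finset.sum_comm]
  congr 1
  exact Finset.sum_congr rfl fun t _ => h.integral_pairing (h.measurable_action t) t

/-! ### Telescoping the potential -/

/-- The logarithmic potential of the posterior marginal `ℙ(astar i = 1 | observed)`. -/
noncomputable def potential (_ : IsThompsonSampling μ A ℓ astar a) (ε : ℝ) (i : Fin d) (n : ℕ) : ℝ :=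
  ∫ ω, Real.log ((μ[fun ω => coord i (astar ω) | observed ℓ a n]) ω + ε) ∂μ

lemma potential_mem_Icc [IsProbabilityMeasure μ] (h : IsThompsonSampling μ A ℓ astar a) {ε : ℝ}
    (hε : 0 < ε) (i : Fin d) (n : ℕ) :
    h.potential ε i n ∈ Set.Icc (Real.log ε) (Real.log (1 + ε)) := by
  have hm := (measurable_coord i).comp h.measurable_astar
  have hint : Integrable (fun ω => coord i (astar ω)) μ :=
    .of_bound hm.aestronglyMeasurable 1 (.of_forall fun ω => by
      rw [Real.norm_eq_abs, abs_of_nonneg (coord_mem_Icc _ _).1]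
      exact (coord_mem_Icc _ _).2)
  have hq := condExp_mem_Icc (h.observed_le n) μ hint fun ω => coord_mem_Icc i (astar ω)
  have hlog : ∀ᵐ ω ∂μ, Real.log ((μ[fun ω => coord i (astar ω) | observed ℓ a n]) ω + ε) ∈
      Set.Icc (Real.log ε) (Real.log (1 + ε)) := by
    filter_upwards [hq] with ω hω
    exact ⟨Real.log_le_log hε (by linarith [hω.1]),
      Real.log_le_log (by linarith [hω.1]) (by linarith [hω.2])⟩
  have hmeas : Measurable fun ω =>
      Real.log ((μ[fun ω => coord i (astar ω) | observed ℓ a n]) ω + ε) :=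
    Real.measurable_log.comp
      ((stronglyMeasurable_condExp.mono (h.observed_le n)).measurable.add_const ε)
  have hI : Integrable (fun ω =>
      Real.log ((μ[fun ω => coord i (astar ω) | observed ℓ a n]) ω + ε)) μ :=
    Integrable.of_mem_Icc _ _ hmeas.aemeasurable hlog
  constructor
  · calc Real.log ε = ∫ _, Real.log ε ∂μ := by simp
      _ ≤ _ := integral_mono_ae (integrable_const _) hI (hlog.mono fun ω hω => hω.1)
  · calc h.potential ε i n ≤ ∫ _, Real.log (1 + ε) ∂μ :=
        integral_mono_ae hI (integrable_const _) (hlog.mono fun ω hω => hω.2)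
      _ = _ := by simp

lemma round_regret_le [IsProbabilityMeasure μ] (h : IsThompsonSampling μ A ℓ astar a) {ε η : ℝ}
    (hε : 0 < ε) (hη : 0 < η) (i : Fin d) (t : Fin T) :
    η * (∫ ω, coord i (a t ω) * ℓ ω t i ∂μ - ∫ ω, coord i (astar ω) * ℓ ω t i ∂μ) ≤
      η * ε + η ^ 2 * ∫ ω, coord i (a t ω) * ℓ ω t i ∂μ
        + (h.potential ε i t - h.potential ε i (t + 1)) := by
  have hH : MeasurableSpace.comap (fun ω => (ℓ ω, astar ω)) inferInstance ≤ mΩ :=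
    (h.measurable_loss.prodMk h.measurable_astar).comap_le
  have hX : Measurable[MeasurableSpace.comap (fun ω => (ℓ ω, astar ω)) inferInstance]
      fun ω => ℓ ω t i :=
    (show Measurable fun p : (Fin T → Fin d → ℝ) × Act d => p.1 t i by fun_prop).comp
      (comap_measurable fun ω => (ℓ ω, astar ω))
  have hZ : Measurable[MeasurableSpace.comap (fun ω => (ℓ ω, astar ω)) inferInstance]
      fun ω => coord i (astar ω) :=
    ((measurable_coord i).comp measurable_snd).comp
      (comap_measurable fun ω => (ℓ ω, astar ω))
  -- `observed ℓ a t` and `history ℓ a t` agree by unfolding, so the posterior in `condExp_coord` is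
  -- the one in the potential.
  exact coordinate_regret_le μ (F := observed ℓ a t) (G := observed ℓ a (t + 1))
    (H := history ℓ a t ⊔ MeasurableSpace.comap (fun ω => (ℓ ω, astar ω)) inferInstance)
    (observed_mono ℓ a (Nat.le_succ _)) le_sup_left (h.observed_le _)
    (sup_le (h.observed_le t) hH)
    (hX.stronglyMeasurable.mono le_sup_right) (hZ.stronglyMeasurable.mono le_sup_right)
    ((measurable_coord i).comp (h.measurable_action t)).stronglyMeasurable
    (stronglyMeasurable_feedback ℓ a t i) (h.loss_mem.mono fun ω hω => hω t i)
    (fun ω => coord_mem_Icc _ _) (fun ω => coord_mem_Icc _ _) (h.condExp_coord t i) hε hη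

/-- The choice `ε = 1 / T` makes the total smoothing cost `T η ε` equal to `η`, while the potential
ranges over an interval of length `log (1 + ε) - log ε = log (T + 1)`. -/
lemma coordinate_regret_sum_le [IsProbabilityMeasure μ] (h : IsThompsonSampling μ A ℓ astar a)
    (hT : 0 < T) {η : ℝ} (hη : 0 < η) (i : Fin d) :
    η * (∑ t, ∫ ω, coord i (a t ω) * ℓ ω t i ∂μ - ∑ t, ∫ ω, coord i (astar ω) * ℓ ω t i ∂μ) ≤
      η + η ^ 2 * ∑ t, ∫ ω, coord i (a t ω) * ℓ ω t i ∂μ + Real.log (T + 1) := by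
  have hT' : (0 : ℝ) < T := by exact_mod_cast hT
  have hε : (0 : ℝ) < (T : ℝ)⁻¹ := inv_pos.2 hT'
  have hs := Finset.sum_le_sum fun t (_ : t ∈ Finset.univ) => h.round_regret_le hε hη i t
  have htel : ∑ t : Fin T, (h.potential (T : ℝ)⁻¹ i t - h.potential (T : ℝ)⁻¹ i (t + 1)) =
      h.potential (T : ℝ)⁻¹ i 0 - h.potential (T : ℝ)⁻¹ i T := by
    rw [Fin.sum_univ_eq_sum_range (fun n : ℕ =>
      h.potential (T : ℝ)⁻¹ i n - h.potential (T : ℝ)⁻¹ i (n + 1)) T, Finset.sum_range_sub']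
  have hc : ∑ _t : Fin T, η * (T : ℝ)⁻¹ = η := by
    simp
    field_simp
  rw [Finset.sum_add_distrib, Finset.sum_add_distrib, hc, htel, ← Finset.mul_sum, ← Finset.mul_sum,
    Finset.sum_sub_distrib] at hs
  have h0 := (h.potential_mem_Icc hε i 0).2
  have h1 := (h.potential_mem_Icc hε i T).1
  have hl : Real.log (1 + (T : ℝ)⁻¹) - Real.log (T : ℝ)⁻¹ = Real.log (T + 1) := by
    rw [← Real.log_div (by positivity) (by positivity)]
    congr 1
    field_simp
  linarith

lemma integral_regret_le [IsProbabilityMeasure μ] (h : IsThompsonSampling μ A ℓ astar a)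
    (hA : A.Nonempty) (hT : 0 < T) {η : ℝ} (hη : 0 < η) :
    η * ∫ ω, regret A hA (ℓ ω) (fun t => a t ω) ∂μ ≤
      d * η + η ^ 2 * (∫ ω, bestLoss A hA (ℓ ω) ∂μ
        + ∫ ω, regret A hA (ℓ ω) (fun t => a t ω) ∂μ) + d * Real.log (T + 1) := by
  have hs := Finset.sum_le_sum fun i (_ : i ∈ Finset.univ) => h.coordinate_regret_sum_le hT hη i
  rw [Finset.sum_add_distrib, Finset.sum_add_distrib, ← Finset.mul_sum, ← Finset.mul_sum,
    Finset.sum_sub_distrib, ← h.integral_bestLoss hA] at hs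
  simp only [Finset.sum_const, Finset.card_univ, Fintype.card_fin, nsmul_eq_mul] at hs
  rw [h.integral_regret hA]
  linarith

end IsThompsonSampling

/-- Optimization of the learning rate `η` in a first-order regret bound. -/
lemma le_of_forall_learning_rate {R L D : ℝ} (hD : 0 < D)
    (h : ∀ η : ℝ, 0 < η → η * R ≤ 2 * D * η + η ^ 2 * (L + R) + 2 * D) :
    R ≤ 16 * (Real.sqrt (D * L) + D) := by
  by_cases hLD : L ≤ 4 * D
  -- At `η = 1 / 2` the hypothesis reads `R / 4 ≤ 3 D + L / 4 ≤ 4 D`, whence the constant 16.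
  · have := h (1 / 2) (by norm_num)
    have := Real.sqrt_nonneg (D * L)
    linarith
  · push Not at hLD
    have hLpos : 0 < L := by linarith
    set s := Real.sqrt (D * L)
    have hss : s * s = D * L := Real.mul_self_sqrt (by positivity)
    have hspos : 0 < s := Real.sqrt_pos.2 (by positivity)
    have hsL : 2 * s ≤ L := by nlinarith
    -- `s / L = √(D / L)` balances `η ^ 2 * L` against `D`.
    have h1 := h (s / L) (by positivity)
    by_contra hR
    push Not at hR
    have hRpos : 0 < R := by nlinarith
    have h2 := mul_le_mul_of_nonneg_right h1 hLpos.le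
    have e : (2 * D * (s / L) + (s / L) ^ 2 * (L + R) + 2 * D) * L =
        2 * D * s + s * s * (L + R) / L + 2 * D * L := by
      field_simp
    rw [e, hss, show D * L * (L + R) / L = D * (L + R) by field_simp,
      show s / L * R * L = s * R by field_simp] at h2
    -- This uses `4 * D < L`; it lets half of `s * R` absorb the term `D * R`.
    have h3 : 2 * D ≤ s := Real.le_sqrt_of_sq_le (by nlinarith)
    have h4 : 2 * D * R ≤ s * R := mul_le_mul_of_nonneg_right h3 hRpos.le
    nlinarith

end SemiBandit

theorem mainTheorem5 :
    ∃ C : ℝ, 0 < C ∧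
      ∀ (d m T : ℕ), 2 ≤ T →
      ∀ (A : Finset (SemiBandit.Act d)) (hA : A.Nonempty),
      (∀ b ∈ A, SemiBandit.size b = m) →
      ∀ {Ω : Type*} [MeasurableSpace Ω] (μ : Measure Ω) [IsProbabilityMeasure μ]
        (ℓ : Ω → Fin T → Fin d → ℝ) (astar : Ω → SemiBandit.Act d)
        (a : Fin T → Ω → SemiBandit.Act d),
      SemiBandit.IsThompsonSampling μ A ℓ astar a →
      ∫ ω, SemiBandit.regret A hA (ℓ ω) (fun t => a t ω) ∂μ ≤
        C * (Real.sqrt (d * (∫ ω, SemiBandit.bestLoss A hA (ℓ ω) ∂μ) * Real.log T)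
          + d * Real.log T) := by
  refine ⟨16, by norm_num, ?_⟩
  intro d m T hT A hA _ Ω _ μ _ ℓ astar a h
  have hT' : (2 : ℝ) ≤ T := by exact_mod_cast hT
  -- The tuning of `η` needs `D = d log T` to be positive; for `d = 0` both sides vanish.
  rcases Nat.eq_zero_or_pos d with rfl | hd
  · have hR := h.integral_regret hA
    rw [h.integral_bestLoss hA] at hR
    simp only [Finset.univ_eq_empty, Finset.sum_empty, sub_zero] at hR
    rw [hR]
    simp
  have hd' : (0 : ℝ) < d := by exact_mod_cast hd
  -- Allows the smoothing cost `d η` to be absorbed into `2 D η`.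
  have hlog2 : 1 / 2 ≤ Real.log T :=
    (by linarith [Real.log_two_gt_d9] : (1 : ℝ) / 2 ≤ Real.log 2).trans
      (Real.log_le_log (by norm_num) hT')
  -- `T + 1 ≤ T ^ 2` for `T ≥ 2`.
  have hlogT : Real.log (T + 1) ≤ 2 * Real.log T := by
    rw [← Real.log_rpow (by linarith)]
    exact Real.log_le_log (by linarith) (by norm_num; nlinarith)
  have key := SemiBandit.le_of_forall_learning_rate (D := d * Real.log T)
    (by positivity) fun η hη => by
      have h1 := h.integral_regret_le hA (by omega) hη
      have h2 : d * η ≤ 2 * (d * Real.log T) * η := by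
        have : d * η * 1 ≤ d * η * (2 * Real.log T) :=
          mul_le_mul_of_nonneg_left (by linarith) (by positivity)
        linarith
      have h3 : d * Real.log (T + 1) ≤ 2 * (d * Real.log T) := by
        have := mul_le_mul_of_nonneg_left hlogT hd'.le
        linarith
      exact h1.trans (by linarith)
  rwa [mul_right_comm] at key
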